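/- A unit square of the lattice $\mathbb{Z}^2$ is a square $[x,x+1]\times[y,y+1]$ with $x,y\in\mathbb{Z}$. A region is a finite set of unit squares, and $\operatorname{M}(R)$ denotes the number of domino tilings of a region $R$, i.e. of coverings of $R$ without gaps or overlaps by dominos (unions of two unit squares that share an edge). The Aztec diamond $AD_n$ of order $n$ is obtained by stacking $2n$ strips of unit height, of respective lengths $2,4,\dots,2n,2n,\dots,4,2$, so that their centers line up along a common vertical lattice line. For $1\le i,j\le n$, let $AD_n^{i,j}$ be the region obtained from $AD_n$ by removing the $i$th unit square on its southwestern boundary and the $j$th unit square on its southeastern boundary, both counted from bottom to top; that is, the leftmost square of the $i$th strip from the bottom and the rightmost square of the $j$th strip from the bottom. Theorem 2.1. (a) For all integers $n,i,j$ with $1\le i,j\le n$, $$\frac{\operatorname{M}(AD_n^{i,j})}{\operatorname{M}(AD_n)}=\sum_{k=0}^{n-1}\binom{k}{i-1}\binom{k}{j-1}\frac{1}{2^{k+1}}.$$ (b) For all fixed integers $i,j\ge 1$, $$\lim_{n\to\infty}\frac{\operatorname{M}(AD_n^{i,j})}{\operatorname{M}(AD_n)}=D(i-1,j-1),$$ where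 $D(k,l)$ is the Delannoy number, i.e. the number of paths on $\mathbb{Z}^2$ from $(0,0)$ to $(k,l)$ using only the steps $(1,0)$, $(0,1)$ and $(1,1)$. -/

import Mathlib

open Filter Topology

/-- A unit square of the square lattice, named by its lower left corner:
`(x, y)` stands for `[x, x + 1] × [y, y + 1]`. A region is a finite set of unit squares. -/
abbrev Cell : Type := ℤ × ℤ

/-- A domino: the union of two unit squares that share an edge. -/
def IsDomino (d : Finset Cell) : Prop :=
  ∃ x y : ℤ, d = {(x, y), (x + 1, y)} ∨ d = {(x, y), (x, y + 1)}

/-- A domino tiling of a region: a set of dominos without overlaps whose union is the region. -/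
def IsDominoTiling (R : Finset Cell) (T : Finset (Finset Cell)) : Prop :=
  (∀ d ∈ T, IsDomino d) ∧
  (∀ d ∈ T, ∀ e ∈ T, d ≠ e → Disjoint d e) ∧
  T.biUnion id = R

/-- The number of domino tilings of a region. -/
noncomputable def numTilings (R : Finset Cell) : ℕ :=
  {T : Finset (Finset Cell) | IsDominoTiling R T}.ncard

/-- There are finitely many domino tilings of a region, so that `numTilings` really counts them. -/
theorem finite_dominoTilings (R : Finset Cell) :
    {T : Finset (Finset Cell) | IsDominoTiling R T}.Finite := by
  refine (R.powerset.powerset).finite_toSet.subset ?_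
  rintro T ⟨-, -, h⟩
  simp only [Finset.mem_coe, Finset.mem_powerset]
  intro d hd
  rw [Finset.mem_powerset, ← h]
  exact Finset.subset_biUnion_of_mem id hd

/-- The Aztec diamond of order `n`: the `2n` strips of unit height at heights `y = 0, …, 2n - 1`,
of lengths `2, 4, …, 2n, 2n, …, 4, 2` from bottom to top, all centered at the line `x = 0`. The strip at height `y` extends from `x = -m` to `x = m`, where
`m` is the smaller one of `y + 1` and `2n - y`. -/
noncomputable def aztecDiamond (n : ℕ) : Finset Cell :=
  (Finset.Ico (-(n : ℤ)) n ×ˢ Finset.Ico (0 : ℤ) (2 * n)).filter fun c =>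
    (-(c.2 + 1) ≤ c.1 ∧ c.1 < c.2 + 1) ∧ (-(2 * n - c.2) ≤ c.1 ∧ c.1 < 2 * n - c.2)

/-- The `i`-th unit square (`1 ≤ i ≤ n`, counted from bottom to top) on the southwestern boundary
of an Aztec diamond of order `n`: the leftmost square of the `i`-th strip. -/
def swSquare (i : ℕ) : Cell := (-(i : ℤ), (i : ℤ) - 1)

/-- The `j`-th unit square (`1 ≤ j ≤ n`, counted from bottom to top) on the southeastern boundary
of an Aztec diamond of order `n`: the rightmost square of the `j`-th strip. -/
def seSquare (j : ℕ) : Cell := ((j : ℤ) - 1, (j : ℤ) - 1)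

/-- The Aztec diamond with the `i`-th southwestern and the `j`-th southeastern boundary squares
removed. -/
noncomputable def dentedAztecDiamond (n i j : ℕ) : Finset Cell :=
  aztecDiamond n \ {swSquare i, seSquare j}

/-- `s` is the list of successive steps of a lattice path from `(0, 0)` to `(k, l)` that uses only
the steps `(1, 0)`, `(0, 1)` and `(1, 1)`. -/
def IsDelannoyPath (k l : ℕ) (s : List (ℤ × ℤ)) : Prop :=
  (∀ v ∈ s, v = (1, 0) ∨ v = (0, 1) ∨ v = (1, 1)) ∧ s.sum = ((k : ℤ), (l : ℤ))

/-- The Delannoy number `D(k, l)`, the number of paths on `ℤ²` from `(0, 0)` to `(k, l)` using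
only the steps `(1, 0)`, `(0, 1)` and `(1, 1)`. -/
noncomputable def delannoy (k l : ℕ) : ℕ :=
  {s : List (ℤ × ℤ) | IsDelannoyPath k l s}.ncard

/-- There are finitely many Delannoy paths, so that `delannoy` really counts them. -/
theorem finite_delannoyPaths (k l : ℕ) :
    {s : List (ℤ × ℤ) | IsDelannoyPath k l s}.Finite := by
  have hlen : ∀ s : List (ℤ × ℤ), (∀ v ∈ s, v = (1, 0) ∨ v = (0, 1) ∨ v = (1, 1)) →
      (s.length : ℤ) ≤ s.sum.1 + s.sum.2 := by
    intro s
    induction s with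
    | nil => intro _; simp
    | cons a t ih =>
      intro h
      have h1 := ih fun v hv => h v (List.mem_cons_of_mem _ hv)
      rcases h a List.mem_cons_self with rfl | rfl | rfl <;>
        simp only [List.length_cons, List.sum_cons, Prod.fst_add, Prod.snd_add] <;>
        push_cast <;> linarith
  let S : Finset (ℤ × ℤ) := {(1, 0), (0, 1), (1, 1)}
  refine ((List.finite_length_le (↥S) (k + l)).image (List.map Subtype.val)).subset ?_
  rintro s ⟨hs, hsum⟩
  refine ⟨s.attach.map fun v => ⟨v.1, ?_⟩, ?_, ?_⟩
  · have := hs v.1 v.2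
    simpa [S] using this
  · have := hlen s hs
    rw [hsum] at this
    have h2 : s.length ≤ k + l := by
      simp only at this
      exact_mod_cast this
    simpa using h2
  · simp [List.map_map, Function.comp_def]
    exact List.attach_map_subtype_val s

/-! Colour the cells like a chessboard. In coordinates along the two lower sides, the odd cells form
an (n+1) × n grid and the even cells an n × (n+1) grid. Let K be the odd-by-even adjacency matrix,
with sign -1 when the even cell is the right neighbour. Then |det K| counts the tilings of the
diamond. Replacing the column of the removed even cell e by the unit vector of the removed odd cell
o gives a determinant that counts the tilings of the dented diamond, because both dents lie on the
boundary (`abs_det_dentedKasteleyn`). By Cramer's rule the ratio is |y(e)|, where K y is the unit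
vector of o.

With Y_d = ∑_c y(c, d) X^c and m = i - 1, this system reads (1 + X) Y_{d+1} = (1 - X) Y_d + [d = m].
That Y_0, ..., Y_n are all polynomials forces Y_0 ≡ -(1 + X)^m / (1 - X)^(m+1) modulo (1 + X)^n.
Expanding in u = 1 + X, where 1 - X = 2 - u, gives `exists_polynomial_column`; the coefficient of
X^(j-1) in Y_0 is, up to sign, the sum in (a).

For (b), Pascal's rule shows that the infinite series satisfies the Delannoy recursion
(`hasSum_choose_mul_choose`). -/

/-! ### Recursion of the Delannoy numbers by the first step of a path. -/

theorem isDelannoyPath_nil_iff (k l : ℕ) : IsDelannoyPath k l [] ↔ k = 0 ∧ l = 0 := by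
  simp only [IsDelannoyPath, List.not_mem_nil, false_implies, implies_true, List.sum_nil, true_and,
    Prod.ext_iff, Prod.fst_zero, Prod.snd_zero]
  omega

theorem IsDelannoyPath.sum_nonneg {s : List (ℤ × ℤ)}
    (h : ∀ v ∈ s, v = (1, 0) ∨ v = (0, 1) ∨ v = (1, 1)) : 0 ≤ s.sum.1 ∧ 0 ≤ s.sum.2 := by
  induction s with
  | nil => simp
  | cons a t ih =>
    have h1 := ih fun v hv => h v (List.mem_cons_of_mem _ hv)
    rcases h a List.mem_cons_self with rfl | rfl | rfl <;>
      simp only [List.sum_cons, Prod.fst_add, Prod.snd_add] <;> omega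

theorem isDelannoyPath_cons_iff (k l : ℕ) (v : ℤ × ℤ) (s : List (ℤ × ℤ)) :
    IsDelannoyPath k l (v :: s) ↔
      (∃ k', k = k' + 1 ∧ v = (1, 0) ∧ IsDelannoyPath k' l s) ∨
      (∃ l', l = l' + 1 ∧ v = (0, 1) ∧ IsDelannoyPath k l' s) ∨
      (∃ k' l', k = k' + 1 ∧ l = l' + 1 ∧ v = (1, 1) ∧ IsDelannoyPath k' l' s) := by
  constructor
  · rintro ⟨h, hs⟩
    have ht : ∀ w ∈ s, w = (1, 0) ∨ w = (0, 1) ∨ w = (1, 1) :=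
      fun w hw => h w (List.mem_cons_of_mem _ hw)
    obtain ⟨h1, h2⟩ := IsDelannoyPath.sum_nonneg ht
    rw [List.sum_cons, Prod.ext_iff] at hs
    simp only [Prod.fst_add, Prod.snd_add] at hs
    rcases h v List.mem_cons_self with rfl | rfl | rfl
    · refine Or.inl ⟨k - 1, by omega, rfl, ht, Prod.ext ?_ ?_⟩ <;> simp only at hs ⊢ <;> omega
    · refine Or.inr (Or.inl ⟨l - 1, by omega, rfl, ht, Prod.ext ?_ ?_⟩) <;> simp only at hs ⊢ <;>
        omega
    · refine Or.inr (Or.inr ⟨k - 1, l - 1, by omega, by omega, rfl, ht, Prod.ext ?_ ?_⟩) <;>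
        simp only at hs ⊢ <;> omega
  · have aux : ∀ (w : ℤ × ℤ) (k' l' : ℕ), (w = (1, 0) ∨ w = (0, 1) ∨ w = (1, 1)) →
        IsDelannoyPath k' l' s → w.1 + k' = k → w.2 + l' = l → IsDelannoyPath k l (w :: s) := by
      rintro w k' l' hw ⟨h, hs⟩ h1 h2
      refine ⟨by simpa [hw] using h, ?_⟩
      rw [List.sum_cons, hs]
      exact Prod.ext h1 h2
    rintro (⟨k', rfl, rfl, h⟩ | ⟨l', rfl, rfl, h⟩ | ⟨k', l', rfl, rfl, rfl, h⟩)
    · exact aux _ _ _ (by simp) h (by push_cast; ring) (by simp)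
    · exact aux _ _ _ (by simp) h (by simp) (by push_cast; ring)
    · exact aux _ _ _ (by simp) h (by push_cast; ring) (by push_cast; ring)

theorem delannoy_zero_zero : delannoy 0 0 = 1 := by
  have : {s : List (ℤ × ℤ) | IsDelannoyPath 0 0 s} = {[]} := by
    ext s
    cases s with
    | nil => simp [isDelannoyPath_nil_iff]
    | cons v s => simp [isDelannoyPath_cons_iff]
  rw [delannoy, this, Set.ncard_singleton]

theorem delannoy_succ_zero (k : ℕ) : delannoy (k + 1) 0 = delannoy k 0 := by
  have : {s : List (ℤ × ℤ) | IsDelannoyPath (k + 1) 0 s} =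
      List.cons (1, 0) '' {s | IsDelannoyPath k 0 s} := by
    ext s
    cases s with
    | nil => simp [isDelannoyPath_nil_iff]
    | cons v s => simp [isDelannoyPath_cons_iff]; tauto
  rw [delannoy, this, Set.ncard_image_of_injective _ (List.cons_injective), delannoy]

theorem delannoy_zero_succ (l : ℕ) : delannoy 0 (l + 1) = delannoy 0 l := by
  have : {s : List (ℤ × ℤ) | IsDelannoyPath 0 (l + 1) s} =
      List.cons (0, 1) '' {s | IsDelannoyPath 0 l s} := by
    ext s
    cases s with
    | nil => simp [isDelannoyPath_nil_iff]
    | cons v s => simp [isDelannoyPath_cons_iff]; tauto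
  rw [delannoy, this, Set.ncard_image_of_injective _ (List.cons_injective), delannoy]

theorem delannoy_succ_succ (k l : ℕ) :
    delannoy (k + 1) (l + 1) = delannoy k (l + 1) + delannoy (k + 1) l + delannoy k l := by
  have : {s : List (ℤ × ℤ) | IsDelannoyPath (k + 1) (l + 1) s} =
      List.cons (1, 0) '' {s | IsDelannoyPath k (l + 1) s} ∪
      List.cons (0, 1) '' {s | IsDelannoyPath (k + 1) l s} ∪
      List.cons (1, 1) '' {s | IsDelannoyPath k l s} := by
    ext s
    cases s with
    | nil => simp [isDelannoyPath_nil_iff]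
    | cons v s => simp [isDelannoyPath_cons_iff]; tauto
  have hf := fun k l => finite_delannoyPaths k l
  rw [delannoy, this, Set.ncard_union_eq _ (((hf _ _).image _).union ((hf _ _).image _))
    ((hf _ _).image _), Set.ncard_union_eq _ ((hf _ _).image _) ((hf _ _).image _)]
  · simp only [Set.ncard_image_of_injective _ List.cons_injective, delannoy]
  · rw [Set.disjoint_left]
    rintro _ ⟨s, -, rfl⟩ ⟨t, -, h⟩
    simp at h
  · rw [Set.disjoint_left]
    rintro _ (⟨s, -, rfl⟩ | ⟨s, -, rfl⟩) ⟨t, -, h⟩ <;> simp at h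

/-! ### The binomial series sums to Delannoy numbers. -/

theorem summable_choose_mul_choose (i j : ℕ) :
    Summable fun k : ℕ => (k.choose i : ℝ) * (k.choose j : ℝ) * (1 / 2 ^ (k + 1)) := by
  have h := summable_pow_mul_geometric_of_norm_lt_one (R := ℝ) (i + j) (r := 1 / 2) (by norm_num)
  refine Summable.of_nonneg_of_le (fun k => by positivity) (fun k => ?_) h
  have h1 : (k.choose i : ℝ) ≤ (k : ℝ) ^ i := by exact_mod_cast Nat.choose_le_pow k i
  have h2 : (k.choose j : ℝ) ≤ (k : ℝ) ^ j := by exact_mod_cast Nat.choose_le_pow k j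
  rw [one_div_pow]
  rw [pow_add (k : ℝ)]
  refine mul_le_mul (mul_le_mul h1 h2 (by positivity) (by positivity)) ?_ (by positivity)
    (by positivity)
  exact one_div_le_one_div_of_le (by positivity) (pow_le_pow_right₀ (by norm_num) k.le_succ)

/-- Let S(i, j) be the sum. Pascal's rule in both binomials of the term at k + 1 gives S(i+1, j+1) =
(S(i, j) + S(i, j+1) + S(i+1, j) + S(i+1, j+1)) / 2. Solving for S(i+1, j+1) yields the Delannoy
recursion; the boundary cases are similar. -/
theorem hasSum_choose_mul_choose (i j : ℕ) :
    HasSum (fun k : ℕ => (k.choose i : ℝ) * (k.choose j : ℝ) * (1 / 2 ^ (k + 1)))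
      (delannoy i j) := by
  -- The index can be shifted by one because the term at k = 0 vanishes unless i = j = 0.
  have shift : ∀ (i j : ℕ) (S : ℝ) (g : ℕ → ℝ), (1 ≤ i ∨ 1 ≤ j) → HasSum g S →
      (∀ k, g k = ((k + 1).choose i : ℝ) * ((k + 1).choose j : ℝ) * (1 / 2 ^ (k + 1 + 1))) →
      ∑' k : ℕ, (k.choose i : ℝ) * (k.choose j : ℝ) * (1 / 2 ^ (k + 1)) = S := by
    intro i j S g hij h hg
    rw [(summable_choose_mul_choose i j).tsum_eq_zero_add]
    have h0 : (((0 : ℕ).choose i : ℕ) : ℝ) * ((0 : ℕ).choose j : ℕ) = 0 := by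
      rcases hij with h | h
      · simp [Nat.choose_eq_zero_of_lt h]
      · simp [Nat.choose_eq_zero_of_lt h]
    rw [h0, zero_mul, zero_add, ← h.tsum_eq]
    exact tsum_congr fun k => (hg k).symm
  have hs := fun i j => (summable_choose_mul_choose i j).hasSum
  suffices h : ∑' k : ℕ, (k.choose i : ℝ) * (k.choose j : ℝ) * (1 / 2 ^ (k + 1)) = delannoy i j by
    rw [← h]; exact hs i j
  induction i generalizing j with
  | zero =>
    induction j with
    | zero =>
      rw [delannoy_zero_zero, Nat.cast_one]
      refine Eq.trans (tsum_congr fun k => ?_) (hasSum_geometric_two' 1).tsum_eq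
      rw [pow_succ, Nat.choose_zero_right]
      field_simp
      norm_num
    | succ j ih =>
      rw [delannoy_zero_succ, ← ih]
      have := shift 0 (j + 1) _ _ (by simp)
        (((hs 0 j).add (hs 0 (j + 1))).mul_left (1 / 2)) (fun k => by
          rw [Nat.choose_succ_succ k j, pow_succ _ (k + 1), Nat.choose_zero_right,
            Nat.choose_zero_right]
          push_cast
          ring)
      linarith
  | succ i ihi =>
    induction j with
    | zero =>
      rw [delannoy_succ_zero, ← ihi]
      have := shift (i + 1) 0 _ _ (by simp)
        (((hs i 0).add (hs (i + 1) 0)).mul_left (1 / 2)) (fun k => by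
          rw [Nat.choose_succ_succ k i, pow_succ _ (k + 1), Nat.choose_zero_right,
            Nat.choose_zero_right]
          push_cast
          ring)
      linarith
    | succ j ihj =>
      rw [delannoy_succ_succ]
      push_cast
      rw [← ihi, ← ihi, ← ihj]
      have := shift (i + 1) (j + 1) _ _ (by simp)
        ((((hs i j).add (hs i (j + 1))).add ((hs (i + 1) j).add (hs (i + 1) (j + 1)))).mul_left
          (1 / 2)) (fun k => by
          rw [Nat.choose_succ_succ k i, Nat.choose_succ_succ k j, pow_succ _ (k + 1)]
          push_cast
          ring)
      linarith

/-! ### Polynomial solution of the Kasteleyn system. -/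

-- Truncation of the power series identity ∑ C(k, m) X^k = X^m / (1 - X)^(m+1), by induction on m
-- with Pascal's rule.
open Polynomial in
theorem X_pow_dvd_choose_sum (n m : ℕ) :
    (X : ℝ[X]) ^ n ∣ (1 - X) ^ (m + 1) * ∑ k ∈ Finset.range n, C (k.choose m : ℝ) * X ^ k - X ^ m := by
  have step : ∀ m, (1 - X : ℝ[X]) * ∑ k ∈ Finset.range n, C (k.choose (m + 1) : ℝ) * X ^ k =
      X * ∑ k ∈ Finset.range n, C (k.choose m : ℝ) * X ^ k - C (n.choose (m + 1) : ℝ) * X ^ n := by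
    intro m
    induction n with
    | zero => simp
    | succ n ih =>
      rw [Finset.sum_range_succ, Finset.sum_range_succ, mul_add, ih, Nat.choose_succ_succ]
      push_cast
      simp only [map_add]
      ring
  induction m with
  | zero =>
    have : (1 - X : ℝ[X]) * ∑ k ∈ Finset.range n, C (k.choose 0 : ℝ) * X ^ k = 1 - X ^ n := by
      simp only [Nat.choose_zero_right, Nat.cast_one, map_one, one_mul]
      exact mul_neg_geom_sum X n
    rw [zero_add, pow_one, this]
    exact ⟨-1, by ring⟩
  | succ m ih =>
    obtain ⟨q, hq⟩ := ih
    refine ⟨X * q - C (n.choose (m + 1) : ℝ) * (1 - X) ^ (m + 1), ?_⟩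
    rw [pow_succ (1 - X), mul_assoc, step]
    linear_combination X * hq

open Polynomial in
theorem one_add_X_pow_dvd_choose_sum (n m : ℕ) :
    (1 + X : ℝ[X]) ^ n ∣ (1 - X) ^ (m + 1) *
      ∑ k ∈ Finset.range n, C ((k.choose m : ℝ) * (1 / 2 ^ (k + 1))) * (1 + X) ^ k - (1 + X) ^ m := by
  obtain ⟨q, hq⟩ := X_pow_dvd_choose_sum n m
  -- Substituting (1 + X)/2 for X turns 1 - X into (1 - X)/2; what remains is to clear powers of 2.
  have h := congrArg (fun p => p.comp (C (1 / 2) * (1 + X))) hq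
  simp only [sub_comp, mul_comp, pow_comp, Polynomial.sum_comp, X_comp, C_comp, one_comp] at h
  have e : (1 - C (1 / 2 : ℝ) * (1 + X)) = C (1 / 2) * (1 - X) := by
    have : (1 : ℝ[X]) = C (1 / 2) + C (1 / 2) := by rw [← C_add]; norm_num
    linear_combination this
  rw [e] at h
  have h2 : ∀ k : ℕ, (C (2 : ℝ)) ^ k * C (1 / 2) ^ k = 1 := by
    intro k
    rw [← mul_pow, ← C_mul]
    norm_num
  refine ⟨C 2 ^ m * C (1 / 2) ^ n * q.comp (C (1 / 2) * (1 + X)), ?_⟩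
  have e2 : ∑ k ∈ Finset.range n, C ((k.choose m : ℝ) * (1 / 2 ^ (k + 1))) * (1 + X) ^ k =
      C (1 / 2) * ∑ k ∈ Finset.range n, C (k.choose m : ℝ) * (C (1 / 2) * (1 + X)) ^ k := by
    rw [Finset.mul_sum]
    refine Finset.sum_congr rfl fun k _ => ?_
    rw [mul_pow, C_mul, ← one_div_pow, C_pow]
    ring
  rw [e2]
  simp only [mul_pow] at h ⊢
  have := h2 m
  linear_combination C 2 ^ m * h -
    ((1 - X) ^ (m + 1) * C (1 / 2) *
      (∑ k ∈ Finset.range n, C (k.choose m : ℝ) * (C (1 / 2) ^ k * (1 + X) ^ k)) - (1 + X) ^ m) * this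

open Polynomial in
/-- Polynomial solution of the linear system that determines a column of the inverse
Kasteleyn matrix of the Aztec diamond. -/
theorem exists_polynomial_column (n m : ℕ) (hm : m < n) :
    ∃ Y : ℕ → ℝ[X], (∀ d ≤ n, (Y d).natDegree < n) ∧
      (∀ d < n, (1 + X) * Y (d + 1) = (1 - X) * Y d + if d = m then 1 else 0) ∧
      Y 0 = -∑ k ∈ Finset.range n, C ((k.choose m : ℝ) * (1 / 2 ^ (k + 1))) * (1 + X) ^ k := by
  set Q : ℝ[X] :=
    ∑ k ∈ Finset.range n, C ((k.choose m : ℝ) * (1 / 2 ^ (k + 1))) * (1 + X) ^ k with hQ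
  have hQm : (1 + X : ℝ[X]) ^ m ∣ Q := by
    refine Finset.dvd_sum fun k _ => ?_
    rcases lt_or_ge k m with h | h
    · simp [Nat.choose_eq_zero_of_lt h]
    · exact (pow_dvd_pow _ h).mul_left _
  -- This is (1 + X)^d Y_d, found by unrolling the recursion from Y_0 = -Q. Divisibility by (1 +
  -- X)^d comes from the congruence for Q when m < d, and from (1 + X)^m ∣ Q when d ≤ m.
  set num : ℕ → ℝ[X] := fun d => -((1 - X) ^ d * Q) +
    if m < d then (1 - X) ^ (d - m - 1) * (1 + X) ^ m else 0 with hnum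
  have hdvd : ∀ d ≤ n, (1 + X : ℝ[X]) ^ d ∣ num d := by
    intro d hd
    simp only [hnum]
    split_ifs with h
    · obtain ⟨r, rfl⟩ : ∃ r, d = m + 1 + r := ⟨d - m - 1, by omega⟩
      have e : -((1 - X) ^ (m + 1 + r) * Q) + (1 - X) ^ (m + 1 + r - m - 1) * (1 + X) ^ m =
          -(1 - X) ^ r * ((1 - X) ^ (m + 1) * Q - (1 + X) ^ m) := by
        rw [show m + 1 + r - m - 1 = r by omega]
        ring
      rw [e]
      exact (pow_dvd_pow _ hd).trans ((one_add_X_pow_dvd_choose_sum n m).mul_left _)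
    · rw [add_zero, dvd_neg]
      exact ((pow_dvd_pow _ (by omega)).trans hQm).mul_left _
  have hex : ∀ d, ∃ y, d ≤ n → num d = (1 + X : ℝ[X]) ^ d * y := by
    intro d
    by_cases hd : d ≤ n
    · obtain ⟨y, hy⟩ := hdvd d hd
      exact ⟨y, fun _ => hy⟩
    · exact ⟨0, fun h => absurd h hd⟩
  choose Y hY using hex
  have hmonic : (1 + X : ℝ[X]).Monic := by
    rw [add_comm]; exact monic_X_add_C 1
  have hrec : ∀ d < n, (1 + X) * Y (d + 1) = (1 - X) * Y d + if d = m then 1 else 0 := by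
    intro d hd
    apply mul_left_cancel₀ (pow_ne_zero d hmonic.ne_zero)
    have h1 := hY d hd.le
    have h2 := hY (d + 1) hd
    have h3 : num (d + 1) = (1 - X) * num d + if d = m then (1 + X) ^ m else 0 := by
      simp only [hnum]
      rcases lt_trichotomy d m with h | h | h
      · rw [if_neg (by omega), if_neg (by omega), if_neg (by omega)]
        ring
      · rw [if_pos (by omega), if_neg (by omega), if_pos h, h,
          show m + 1 - m - 1 = 0 by omega]
        ring
      · rw [if_pos (by omega), if_pos (by omega), if_neg (by omega)]
        obtain ⟨r, rfl⟩ : ∃ r, d = m + 1 + r := ⟨d - m - 1, by omega⟩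
        rw [show m + 1 + r - m - 1 = r by omega, show m + 1 + r + 1 - m - 1 = r + 1 by omega]
        ring
    rw [h1, h2] at h3
    have h4 : (1 + X : ℝ[X]) ^ d * (if d = m then 1 else 0) = if d = m then (1 + X) ^ m else 0 := by
      split_ifs with h
      · rw [h, mul_one]
      · rw [mul_zero]
    linear_combination h3 - h4
  have h0 : Y 0 = -Q := by
    have := hY 0 (Nat.zero_le n)
    simpa [hnum] using this.symm
  refine ⟨Y, fun d hd => ?_, hrec, h0⟩
  have hd1 : (1 + X : ℝ[X]).natDegree = 1 := by
    rw [add_comm]; exact natDegree_X_add_C 1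
  induction d with
  | zero =>
    rw [h0, natDegree_neg]
    refine (Nat.le_sub_one_iff_lt (by omega)).1 (natDegree_sum_le_of_forall_le _ _ fun k hk => ?_)
    refine (natDegree_C_mul_le _ _).trans (natDegree_pow_le.trans ?_)
    rw [hd1]
    have := Finset.mem_range.1 hk
    omega
  | succ d ih =>
    have ih' := ih (by omega)
    -- The factor 1 + X adds exactly one to the degree on the left, while the right side gains at
    -- most one, so the degree of Y_d never grows.
    have h := congrArg natDegree (hrec d hd)
    by_cases hz : Y (d + 1) = 0
    · rw [hz, natDegree_zero]; omega
    rw [natDegree_mul hmonic.ne_zero hz, hd1] at h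
    have h5 : ((1 - X) * Y d + if d = m then 1 else 0 : ℝ[X]).natDegree ≤ 1 + (Y d).natDegree := by
      refine natDegree_add_le_of_degree_le ?_ ?_
      · refine natDegree_mul_le.trans (Nat.add_le_add_right ?_ _)
        refine (natDegree_sub_le _ _).trans ?_
        simp
      · split_ifs <;> simp
    omega

/-! ### Signs: the Kasteleyn determinants count matchings. -/

/-- If the products of the weights of the bijections in `P` all have the same value `κ = ±1` once
they are corrected by the inversion sign, and those of the other bijections vanish, then the
determinant of the weights counts `P`. -/
theorem abs_det_eq_card {N : ℕ} {E : Type*} [Fintype E] [DecidableEq E] (ρ : E ≃ Fin N)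
    (ε : E → E → ℝ) (hε : ∀ e e', ε e e' = -ε e' e) (hε1 : ∀ e e', e ≠ e' → |ε e e'| = 1)
    (W : Fin N → E → ℝ) (P : Finset (Fin N ≃ E)) (κ : ℝ) (hκ : |κ| = 1)
    (h0 : ∀ f, f ∉ P → ∏ i, W i (f i) = 0)
    (h1 : ∀ f ∈ P, (∏ i, ∏ j ∈ Finset.Ioi i, ε (f i) (f j)) * ∏ i, W i (f i) = κ) :
    |(Matrix.of fun i j => W i (ρ.symm j)).det| = P.card := by
  set G : ℝ := ∏ i : Fin N, ∏ j ∈ Finset.Ioi i, ε (ρ.symm i) (ρ.symm j) with hG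
  have hG1 : |G| = 1 := by
    rw [hG, Finset.abs_prod]
    refine Finset.prod_eq_one fun i _ => ?_
    rw [Finset.abs_prod]
    refine Finset.prod_eq_one fun j hj => hε1 _ _ fun h => ?_
    exact (Finset.mem_Ioi.1 hj).ne (ρ.symm.injective h)
  have hGG : G * G = 1 := by
    rw [← abs_mul_abs_self, hG1, one_mul]
  have hsign : ∀ σ : Equiv.Perm (Fin N), ((Equiv.Perm.sign σ : ℤ) : ℝ) =
      G * ∏ i, ∏ j ∈ Finset.Ioi i, ε (ρ.symm (σ i)) (ρ.symm (σ j)) := by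
    intro σ
    have := σ.prod_Ioi_comp_eq_sign_mul_prod (f := fun i j => ε (ρ.symm i) (ρ.symm j))
      (fun i j => hε _ _)
    rw [this, ← hG, mul_comm, mul_assoc, hGG, mul_one]
  have key : (Matrix.of fun i j => W i (ρ.symm j)).det = G * κ * P.card := by
    rw [← Matrix.det_transpose, Matrix.det_apply']
    calc _ = ∑ f : Fin N ≃ E, G * ((∏ i, ∏ j ∈ Finset.Ioi i, ε (f i) (f j)) *
            ∏ i, W i (f i)) := by
          refine Fintype.sum_equiv (Equiv.equivCongr (Equiv.refl _) ρ.symm) _ _ fun σ => ?_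
          rw [hsign, mul_assoc]
          rfl
      _ = ∑ f ∈ P, G * κ := by
          symm
          refine Finset.sum_subset_zero_on_sdiff (Finset.subset_univ _) ?_ ?_
          · intro f hf
            rw [h0 f (by simpa using hf)]
            simp
          · intro f hf
            rw [h1 f hf]
      _ = _ := by
          rw [Finset.sum_const, nsmul_eq_mul, mul_comm]
  rw [key, abs_mul, abs_mul, hG1, hκ]
  simp

/-- A bijection `f : Fin N ≃ Fin n × Fin (n + 1)`, whose source carries coordinates `a`, `b`,
matches adjacent cells of the Aztec diamond, except that it maps `o` to `e` if `D` holds. -/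
def IsAztecMatching {N n : ℕ} (a b : Fin N → ℕ) (D : Prop) (o : Fin N) (e : Fin n × Fin (n + 1))
    (f : Fin N ≃ Fin n × Fin (n + 1)) : Prop :=
  (D → f o = e) ∧ ∀ i, ¬ (D ∧ i = o) →
    ((f i).1.1 = a i ∨ (f i).1.1 + 1 = a i) ∧ ((f i).2.1 = b i ∨ (f i).2.1 = b i + 1)

/-- The sign of a pair of elements of `Fin n × Fin (n + 1)` in the lexicographic order. -/
def lexSign {n : ℕ} (e e' : Fin n × Fin (n + 1)) : ℝ :=
  if e.1 < e'.1 ∨ e.1 = e'.1 ∧ e.2 < e'.2 then 1 else if e = e' then 0 else -1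

theorem lexSign_antisymm {n : ℕ} (e e' : Fin n × Fin (n + 1)) : lexSign e e' = -lexSign e' e := by
  obtain ⟨c, d⟩ := e
  obtain ⟨c', d'⟩ := e'
  simp only [lexSign, Prod.mk.injEq]
  split_ifs <;> first | (exfalso; omega) | norm_num

theorem abs_lexSign {n : ℕ} (e e' : Fin n × Fin (n + 1)) (h : e ≠ e') : |lexSign e e'| = 1 := by
  rw [lexSign, if_neg h]
  split_ifs <;> norm_num

/-- The Kasteleyn weights of the Aztec diamond. -/
def kasteleyn {N n : ℕ} (a b : Fin N → ℕ) (i : Fin N) (e : Fin n × Fin (n + 1)) : ℝ :=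
  if e.1.1 = a i ∧ e.2.1 = b i then -1
  else if (e.1.1 = a i ∨ e.1.1 + 1 = a i) ∧ (e.2.1 = b i ∨ e.2.1 = b i + 1) then 1 else 0

section
variable {N n : ℕ} (a b : Fin N → ℕ) (D : Prop) [Decidable D] (o : Fin N) (e : Fin n × Fin (n + 1))

/-- Part of the sign of the pair `(f i, f j)` attributed to the ordered pair `(i, j)`. -/
def pairSign (f : Fin N ≃ Fin n × Fin (n + 1)) (i j : Fin N) : ℝ :=
  if D ∧ i = o then lexSign e (f j)
  else (if (f i).1.1 = a i ∧ a j = a i ∧ b i < b j then -1 else 1) *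
    (if (f i).1.1 = a i ∧ ¬ (D ∧ j = o) ∧ (f j).1 = (f i).1 ∧ (f j).2 < (f i).2 then -1 else 1)

variable (hlex : ∀ i j, i < j ↔ a i < a j ∨ a i = a j ∧ b i < b j)
  (ho : a o = 0)
include hlex ho

-- Write f i = (c, d) and f j = (c', d'), with neither index dented. If a i < a j, an inversion
-- needs c = c' = a i and d' < d, which is the second factor of `pairSign` at (i, j). If a i = a j
-- and b i < b j, an inversion occurs exactly for c = a i, c' = a i - 1; when c = c' = a i, the
-- first factor at (i, j) cancels the second factor at (j, i). Pairs with the dent use a o = 0: an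
-- undented index in odd column 0 must be matched into even column 0.
set_option maxHeartbeats 1000000 in
theorem lexSign_eq_pairSign_mul (f : Fin N ≃ Fin n × Fin (n + 1))
    (hf : IsAztecMatching a b D o e f) (i j : Fin N) (hij : i < j) :
    lexSign (f i) (f j) = pairSign a b D o e f j i * pairSign a b D o e f i j := by
  have hne : f i ≠ f j := fun h => hij.ne (f.injective h)
  have hl := (hlex i j).1 hij
  by_cases hi : D ∧ i = o
  · have hj : ¬ (D ∧ j = o) := fun h => hij.ne (hi.2.trans h.2.symm)
    have h2 := hf.2 j hj
    have hfo := hf.1 hi.1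
    rw [← hi.2] at ho hfo
    have e1 : pairSign a b D o e f i j = lexSign e (f j) := if_pos hi
    have e2 : pairSign a b D o e f j i = 1 := by
      rw [pairSign, if_neg hj, if_neg (by omega), if_neg (by tauto), one_mul]
    rw [e1, e2, hfo, one_mul]
  have h1 := hf.2 i hi
  by_cases hj : D ∧ j = o
  · have hfo := hf.1 hj.1
    rw [← hj.2] at ho hfo
    have e1 : pairSign a b D o e f j i = lexSign e (f i) := if_pos hj
    have e2 : pairSign a b D o e f i j = -1 := by
      rw [pairSign, if_neg hi, if_pos (by omega), if_neg (by tauto), mul_one]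
    rw [e1, e2, lexSign_antisymm, hfo, mul_neg_one]
  have h2 := hf.2 j hj
  rw [pairSign, if_neg hj, pairSign, if_neg hi]
  simp only [hi, hj, not_false_eq_true, true_and, lexSign, if_neg hne]
  clear hi hj ho hlex hf
  generalize f i = p at *
  generalize f j = q at *
  obtain ⟨⟨c, hc⟩, ⟨d, hd⟩⟩ := p
  obtain ⟨⟨c', hc'⟩, ⟨d', hd'⟩⟩ := q
  simp only [ne_eq, Prod.mk.injEq, Fin.mk.injEq, Fin.mk_lt_mk] at *
  have hd1 := h1.2
  have hd2 := h2.2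
  rcases hl with hl | ⟨hl, hb⟩
  · rw [if_neg (c := _ ∧ a i = a j ∧ _) (by omega), if_neg (c := _ ∧ a j = a i ∧ _) (by omega)]
    rcases h1.1 with hc1 | hc1 <;> rcases h2.1 with hc2 | hc2 <;> clear h1 h2 <;>
      split_ifs <;> first | (exfalso; omega) | norm_num
  · rw [if_neg (c := _ ∧ a i = a j ∧ _) (by omega)]
    rcases h1.1 with hc1 | hc1 <;> rcases h2.1 with hc2 | hc2 <;> clear h1 h2 <;>
      split_ifs <;> first | (exfalso; omega) | norm_num

end

theorem prod_neg_one_lt {n : ℕ} (c : Fin n) (d : Fin (n + 1)) :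
    ∏ x : Fin n × Fin (n + 1), (if x.1 = c ∧ x.2 < d then (-1 : ℝ) else 1) = (-1) ^ d.1 := by
  rw [Finset.prod_ite, Finset.prod_const, Finset.prod_const_one, mul_one]
  congr 1
  have : (Finset.univ.filter fun x : Fin n × Fin (n + 1) => x.1 = c ∧ x.2 < d) =
      {c} ×ˢ Finset.Iio d := by
    ext ⟨x, y⟩
    simp [and_comm, eq_comm]
  rw [this, Finset.card_product]
  simp

/-- As e is the lowest cell of its column, leaving it out of the count below p changes the sign for
every other p of that column, whatever its height. -/
theorem prod_neg_one_lt_of_ne {n : ℕ} (D : Prop) [Decidable D] (e p : Fin n × Fin (n + 1))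
    (he : e.2 = 0) (hp : D → p ≠ e) :
    ∏ x : Fin n × Fin (n + 1), (if ¬ (D ∧ x = e) ∧ x.1 = p.1 ∧ x.2 < p.2 then (-1 : ℝ) else 1) =
      (-1) ^ p.2.1 * if D ∧ p.1 = e.1 then -1 else 1 := by
  have h1 : ∏ x : Fin n × Fin (n + 1), (if D ∧ x = e ∧ p.1 = e.1 then (-1 : ℝ) else 1) =
      if D ∧ p.1 = e.1 then -1 else 1 := by
    rw [Fintype.prod_eq_single e (fun x hx => if_neg (by tauto))]
    simp
  rw [← prod_neg_one_lt p.1, ← h1, ← Finset.prod_mul_distrib]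
  refine Finset.prod_congr rfl fun x _ => ?_
  by_cases hx : D ∧ x = e
  · obtain ⟨hD, rfl⟩ := hx
    rw [if_neg (by simp [hD])]
    by_cases hc : p.1 = x.1
    · have : x.2 < p.2 := by
        rw [he]
        refine Fin.pos_of_ne_zero fun h => hp hD (Prod.ext hc (h.trans he.symm))
      simp [hD, hc, this]
    · simp [hc, Ne.symm hc]
  · have : ¬ (D ∧ x = e ∧ p.1 = e.1) := by tauto
    simp [hx, this]

section
variable {N n : ℕ} (a b : Fin N → ℕ) (D : Prop) [Decidable D] (o : Fin N) (e : Fin n × Fin (n + 1))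

/-- If f i = (a i, d), there are n - 1 - b i odd cells above i in its column and d even cells below
f i. The exponent is n - 1 or n according as d = b i or d = b i + 1, and the Kasteleyn sign evens
this out. The result depends on f only through the column of f i. -/
theorem prod_pairSign_mul_kasteleyn (he : e.2 = 0)
    (hcard : ∀ i, (Finset.univ.filter fun j => a j = a i ∧ b i < b j).card + b i + 1 = n)
    (f : Fin N ≃ Fin n × Fin (n + 1)) (hf : IsAztecMatching a b D o e f) (i : Fin N)
    (hi : ¬ (D ∧ i = o)) :
    (∏ j ∈ {i}ᶜ, pairSign a b D o e f i j) * kasteleyn a b i (f i) =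
      if (f i).1.1 = a i then (-1) ^ n * (if D ∧ a i = e.1.1 then -1 else 1) else 1 := by
  have hadj := hf.2 i hi
  have hprod : ∏ j ∈ {i}ᶜ, pairSign a b D o e f i j = ∏ j, pairSign a b D o e f i j := by
    refine Finset.prod_subset (Finset.subset_univ _) fun j _ hj => ?_
    obtain rfl : j = i := by simpa using hj
    simp [pairSign, hi]
  rw [hprod]
  simp only [pairSign, if_neg hi]
  by_cases hc : (f i).1.1 = a i
  · have hA : ∏ j, (if (f i).1.1 = a i ∧ a j = a i ∧ b i < b j then (-1 : ℝ) else 1) =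
        (-1) ^ (Finset.univ.filter fun j => a j = a i ∧ b i < b j).card := by
      simp [hc, Finset.prod_ite]
    have hB : ∏ j, (if (f i).1.1 = a i ∧ ¬ (D ∧ j = o) ∧ (f j).1 = (f i).1 ∧ (f j).2 < (f i).2
        then (-1 : ℝ) else 1) = (-1) ^ (f i).2.1 * if D ∧ (f i).1 = e.1 then -1 else 1 := by
      rw [← prod_neg_one_lt_of_ne D e (f i) he, ← Equiv.prod_comp f]
      · refine Finset.prod_congr rfl fun j _ => ?_
        have : (D ∧ j = o) ↔ (D ∧ f j = e) :=
          and_congr_right fun hD => by rw [← hf.1 hD, f.injective.eq_iff]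
        simp [hc, this]
      · intro hD h
        exact hi ⟨hD, f.injective (h.trans (hf.1 hD).symm)⟩
    have hce : (f i).1 = e.1 ↔ a i = e.1.1 := by rw [← hc, Fin.ext_iff]
    rw [Finset.prod_mul_distrib, hA, hB, if_pos hc]
    simp only [hce]
    have hn := hcard i
    have key : (-1 : ℝ) ^ (Finset.univ.filter fun j => a j = a i ∧ b i < b j).card *
        (-1) ^ (f i).2.1 * kasteleyn a b i (f i) = (-1) ^ n := by
      have hpow : (-1 : ℝ) ^ n = (-1) ^
          ((Finset.univ.filter fun j => a j = a i ∧ b i < b j).card + b i + 1) := by rw [hn]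
      rw [hpow, ← pow_add]
      rcases hadj.2 with hd | hd
      · rw [kasteleyn, if_pos ⟨hc, hd⟩, hd, pow_succ]
      · rw [kasteleyn, if_neg (by omega), if_pos hadj, hd, mul_one, add_assoc]
    rw [← key]
    ring
  · have hK : kasteleyn a b i (f i) = 1 := by
      rw [kasteleyn, if_neg (fun h => hc h.1), if_pos hadj]
    simp [hc, hK]

/-- The Kasteleyn matrix, with the column of `e` replaced by the unit vector of `o` if `D` holds. -/
def dentedKasteleyn (i : Fin N) (p : Fin n × Fin (n + 1)) : ℝ :=
  if D ∧ p = e then (if i = o then 1 else 0) else kasteleyn a b i p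

theorem prod_dentedKasteleyn_eq_zero (f : Fin N ≃ Fin n × Fin (n + 1))
    (hf : ¬ IsAztecMatching a b D o e f) : ∏ i, dentedKasteleyn a b D o e i (f i) = 0 := by
  by_cases h : D ∧ f o ≠ e
  · refine Finset.prod_eq_zero (Finset.mem_univ (f.symm e)) ?_
    have h2 : f.symm e ≠ o := fun h3 => h.2 (by rw [← h3, f.apply_symm_apply])
    simp [dentedKasteleyn, h.1, h2]
  · have h1 : D → f o = e := by tauto
    simp only [IsAztecMatching, not_and_or, not_forall] at hf
    rcases hf with ⟨hD, hn⟩ | ⟨i, hi, hadj⟩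
    · exact absurd (h1 hD) hn
    · refine Finset.prod_eq_zero (Finset.mem_univ i) ?_
      have h2 : ¬ (D ∧ f i = e) := fun h3 => not_and_or.2 hi ⟨h3.1, f.injective (h3.2.trans (h1 h3.1).symm)⟩
      rw [dentedKasteleyn, if_neg h2, kasteleyn, if_neg (by tauto), if_neg (by tauto)]

theorem abs_det_dentedKasteleyn (ρ : Fin n × Fin (n + 1) ≃ Fin N)
    (hlex : ∀ i j, i < j ↔ a i < a j ∨ a i = a j ∧ b i < b j)
    (ho : a o = 0) (he : e.2 = 0)
    (hcard : ∀ i, (Finset.univ.filter fun j => a j = a i ∧ b i < b j).card + b i + 1 = n) :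
    |(Matrix.of fun i j => dentedKasteleyn a b D o e i (ρ.symm j)).det| =
      {f : Fin N ≃ Fin n × Fin (n + 1) | IsAztecMatching a b D o e f}.ncard := by
  classical
  set φ : ℕ → ℝ := fun k => (-1) ^ n * (if D ∧ k = e.1.1 then -1 else 1) with hφ
  -- Running products of φ: since φ k = α k * α (k + 1), the contribution of i becomes α (a i) * α
  -- (c + 1), with c the column of f i, whether c = a i or c = a i - 1. The total product then
  -- splits over odd and even cells and no longer depends on f.
  set α : ℕ → ℝ := fun k => ∏ l ∈ Finset.range k, φ l with hα
  have hφ1 : ∀ k, |φ k| = 1 := by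
    intro k
    simp only [hφ, abs_mul, abs_pow, abs_neg, abs_one, one_pow, one_mul]
    split_ifs <;> simp
  have hα1 : ∀ k, |α k| = 1 := by
    intro k
    rw [hα, Finset.abs_prod]
    exact Finset.prod_eq_one fun l _ => hφ1 l
  have hαα : ∀ k, α k * α k = 1 := fun k => by rw [← abs_mul_abs_self, hα1, one_mul]
  set L : ℝ := ∏ p ∈ {e}ᶜ, lexSign e p with hL
  have hL1 : |L| = 1 := by
    rw [hL, Finset.abs_prod]
    refine Finset.prod_eq_one fun p hp => abs_lexSign _ _ ?_
    exact fun h => by simp [h] at hp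
  set κ : ℝ := (∏ i, if D ∧ i = o then L else α (a i)) *
    ∏ p : Fin n × Fin (n + 1), if D ∧ p = e then 1 else α (p.1.1 + 1) with hκ
  have hP : {f : Fin N ≃ Fin n × Fin (n + 1) | IsAztecMatching a b D o e f} =
      ↑(Finset.univ.filter fun f => IsAztecMatching a b D o e f) := by ext; simp
  rw [hP, Set.ncard_coe_finset]
  refine abs_det_eq_card ρ lexSign lexSign_antisymm abs_lexSign
    (dentedKasteleyn a b D o e) _ κ ?_ ?_ ?_
  · rw [hκ, abs_mul, Finset.abs_prod, Finset.abs_prod, Finset.prod_eq_one, Finset.prod_eq_one,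
      one_mul]
    · intro p _
      split_ifs <;> simp [hα1]
    · intro i _
      split_ifs <;> simp [hα1, hL1]
  · intro f hf
    exact prod_dentedKasteleyn_eq_zero a b D o e f (by simpa using hf)
  · intro f hf
    have hf : IsAztecMatching a b D o e f := by simpa using hf
    have h1 : ∏ i, ∏ j ∈ Finset.Ioi i, lexSign (f i) (f j) =
        ∏ i, ∏ j ∈ {i}ᶜ, pairSign a b D o e f i j := by
      rw [← Finset.prod_prod_Ioi_mul_eq_prod_prod_off_diag
        (fun j i => pairSign a b D o e f i j)]
      refine Finset.prod_congr rfl fun i _ => Finset.prod_congr rfl fun j hj => ?_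
      rw [lexSign_eq_pairSign_mul a b D o e hlex ho f hf i j (Finset.mem_Ioi.1 hj), mul_comm]
    rw [h1, ← Finset.prod_mul_distrib, hκ, ← Equiv.prod_comp f, ← Finset.prod_mul_distrib]
    refine Finset.prod_congr rfl fun i _ => ?_
    by_cases hi : D ∧ i = o
    · have hfe : f i = e := by rw [hi.2]; exact hf.1 hi.1
      have hc : ∏ j ∈ {i}ᶜ, pairSign a b D o e f i j = L := by
        rw [hL]
        refine Finset.prod_bij (fun j _ => f j) ?_ ?_ ?_ ?_
        · intro j hj
          simp only [Finset.mem_compl, Finset.mem_singleton] at hj ⊢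
          exact fun h => hj (f.injective (h.trans hfe.symm))
        · intro j _ k _ h
          exact f.injective h
        · intro p hp
          simp only [Finset.mem_compl, Finset.mem_singleton] at hp
          refine ⟨f.symm p, ?_, by simp⟩
          simp only [Finset.mem_compl, Finset.mem_singleton]
          exact fun h => hp (by rw [← hfe, ← h, f.apply_symm_apply])
        · intro j _
          rw [pairSign, if_pos hi]
      rw [hc, if_pos hi, if_pos ⟨hi.1, hfe⟩, dentedKasteleyn, if_pos ⟨hi.1, hfe⟩, if_pos hi.2]
    · have hfe : ¬ (D ∧ f i = e) :=
        fun h => hi ⟨h.1, f.injective (h.2.trans (hf.1 h.1).symm)⟩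
      rw [if_neg hi, if_neg hfe, dentedKasteleyn, if_neg hfe,
        prod_pairSign_mul_kasteleyn a b D o e he hcard f hf i hi]
      rcases (hf.2 i hi).1 with hc | hc
      · rw [if_pos hc, hc]
        have : α (a i + 1) = α (a i) * φ (a i) := Finset.prod_range_succ _ _
        rw [this, ← mul_assoc, hαα, one_mul]
      · rw [if_neg (by omega), hc, hαα]

end

/-! ### Rotated coordinates on the cells of the diamond. -/

/-- The coordinate of `i` along the southeastern boundary. -/
def oddColumn (n : ℕ) (i : Fin ((n + 1) * n)) : ℕ := i.divNat

/-- The coordinate of `i` along the southwestern boundary. -/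
def oddRow (n : ℕ) (i : Fin ((n + 1) * n)) : ℕ := i.modNat

/-- The unit squares of the colour of the southwestern boundary. -/
def oddCell (n : ℕ) (i : Fin ((n + 1) * n)) : Cell :=
  ((oddColumn n i : ℤ) - oddRow n i - 1, (oddColumn n i : ℤ) + oddRow n i)

/-- The unit squares of the colour of the southeastern boundary. -/
def evenCell (n : ℕ) (p : Fin n × Fin (n + 1)) : Cell :=
  ((p.1 : ℤ) - p.2, (p.1 : ℤ) + p.2)

theorem oddColumn_lt {n : ℕ} (i : Fin ((n + 1) * n)) : oddColumn n i < n + 1 := i.divNat.2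

theorem oddRow_lt {n : ℕ} (i : Fin ((n + 1) * n)) : oddRow n i < n := i.modNat.2

theorem exists_oddColumn_oddRow {n x y : ℕ} (hx : x < n + 1) (hy : y < n) :
    ∃ i, oddColumn n i = x ∧ oddRow n i = y := by
  refine ⟨finProdFinEquiv (⟨x, hx⟩, ⟨y, hy⟩), ?_⟩
  have h := finProdFinEquiv.symm_apply_apply ((⟨x, hx⟩, ⟨y, hy⟩) : Fin (n + 1) × Fin n)
  rw [finProdFinEquiv_symm_apply] at h
  simp only [Prod.ext_iff, Fin.ext_iff] at h
  exact h

theorem oddRow_add_mul {n : ℕ} (i : Fin ((n + 1) * n)) :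
    oddRow n i + n * oddColumn n i = i := Nat.mod_add_div _ _

theorem eq_of_oddColumn_of_oddRow {n : ℕ} {i j : Fin ((n + 1) * n)}
    (h1 : oddColumn n i = oddColumn n j) (h2 : oddRow n i = oddRow n j) : i = j := by
  rw [Fin.ext_iff, ← oddRow_add_mul i, ← oddRow_add_mul j, h1, h2]

theorem lt_iff_oddColumn_oddRow {n : ℕ} (i j : Fin ((n + 1) * n)) :
    i < j ↔ oddColumn n i < oddColumn n j ∨ oddColumn n i = oddColumn n j ∧
      oddRow n i < oddRow n j := by
  have key : ∀ i j : Fin ((n + 1) * n), oddColumn n i < oddColumn n j → i < j := by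
    intro i j h
    rw [Fin.lt_def, ← oddRow_add_mul i, ← oddRow_add_mul j]
    have := oddRow_lt i
    have := Nat.mul_le_mul_left n h
    rw [Nat.succ_eq_add_one, mul_add, mul_one] at this
    omega
  rcases lt_trichotomy (oddColumn n i) (oddColumn n j) with h | h | h
  · simp [h, key i j h]
  · rw [Fin.lt_def, ← oddRow_add_mul i, ← oddRow_add_mul j, h]
    omega
  · have := key j i h
    constructor
    · intro h'
      exact absurd this h'.asymm
    · omega

theorem card_oddRow_gt {n : ℕ} (i : Fin ((n + 1) * n)) :
    (Finset.univ.filter fun j => oddColumn n j = oddColumn n i ∧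
      oddRow n i < oddRow n j).card + oddRow n i + 1 = n := by
  have h := oddRow_lt i
  have : (Finset.univ.filter fun j => oddColumn n j = oddColumn n i ∧
      oddRow n i < oddRow n j).card = (Finset.Ioo (oddRow n i) n).card := by
    refine Finset.card_bij (fun j _ => oddRow n j) ?_ ?_ ?_
    · intro j hj
      simp only [Finset.mem_filter] at hj
      exact Finset.mem_Ioo.2 ⟨hj.2.2, oddRow_lt j⟩
    · intro j hj k hk hjk
      simp only [Finset.mem_filter] at hj hk
      exact eq_of_oddColumn_of_oddRow (hj.2.1.trans hk.2.1.symm) hjk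
    · intro y hy
      rw [Finset.mem_Ioo] at hy
      obtain ⟨j, hj1, hj2⟩ := exists_oddColumn_oddRow (oddColumn_lt i) hy.2
      exact ⟨j, by simp [hj1, hj2, hy.1], hj2⟩
  rw [this, Nat.card_Ioo]
  omega

theorem oddCell_injective (n : ℕ) : Function.Injective (oddCell n) := by
  intro i j h
  simp only [oddCell, Prod.mk.injEq] at h
  exact eq_of_oddColumn_of_oddRow (by omega) (by omega)

theorem evenCell_injective (n : ℕ) : Function.Injective (evenCell n) := by
  rintro ⟨⟨c, hc⟩, ⟨d, hd⟩⟩ ⟨⟨c', hc'⟩, ⟨d', hd'⟩⟩ h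
  simp only [evenCell, Prod.mk.injEq] at h
  simp only [Prod.mk.injEq, Fin.mk.injEq]
  omega

theorem oddCell_ne_evenCell {n : ℕ} (i : Fin ((n + 1) * n)) (p : Fin n × Fin (n + 1)) :
    oddCell n i ≠ evenCell n p := by
  intro h
  simp only [oddCell, evenCell, Prod.mk.injEq] at h
  omega

theorem mem_aztecDiamond_iff {n : ℕ} (x : Cell) :
    x ∈ aztecDiamond n ↔ (∃ i, oddCell n i = x) ∨ ∃ p, evenCell n p = x := by
  obtain ⟨x, y⟩ := x
  simp only [aztecDiamond, Finset.mem_filter, Finset.mem_product, Finset.mem_Ico]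
  constructor
  · rintro ⟨⟨⟨h1, h2⟩, h3, h4⟩, ⟨h5, h6⟩, h7, h8⟩
    rcases Int.even_or_odd' (x + y) with ⟨k, hk | hk⟩
    · right
      refine ⟨(⟨k.toNat, by omega⟩, ⟨(y - k).toNat, by omega⟩), ?_⟩
      simp only [evenCell, Prod.mk.injEq]
      omega
    · left
      obtain ⟨i, hi1, hi2⟩ := exists_oddColumn_oddRow (n := n) (x := (k + 1).toNat)
        (y := (y - (k + 1)).toNat) (by omega) (by omega)
      refine ⟨i, ?_⟩
      simp only [oddCell, Prod.mk.injEq, hi1, hi2]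
      omega
  · rintro (⟨i, hi⟩ | ⟨⟨⟨c, hc⟩, ⟨d, hd⟩⟩, hp⟩)
    · have h1 := oddColumn_lt i
      have h2 := oddRow_lt i
      simp only [oddCell, Prod.mk.injEq] at hi
      omega
    · simp only [evenCell, Prod.mk.injEq] at hp
      omega

theorem isDomino_iff_adjacent {n : ℕ} (i : Fin ((n + 1) * n)) (p : Fin n × Fin (n + 1)) :
    IsDomino {oddCell n i, evenCell n p} ↔
      (p.1.1 = oddColumn n i ∨ p.1.1 + 1 = oddColumn n i) ∧
        (p.2.1 = oddRow n i ∨ p.2.1 = oddRow n i + 1) := by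
  have pair : ∀ x y z w : Cell, ({x, y} : Finset Cell) = {z, w} ↔
      x = z ∧ y = w ∨ x = w ∧ y = z := by
    intro x y z w
    rw [← Finset.coe_inj]
    push_cast
    exact Set.pair_eq_pair_iff
  obtain ⟨⟨c, hc⟩, ⟨d, hd⟩⟩ := p
  simp only [IsDomino, pair, oddCell, evenCell, Prod.mk.injEq]
  constructor
  · rintro ⟨x, y, h⟩
    omega
  · rintro ⟨h1 | h1, h2 | h2⟩
    · exact ⟨_, _, Or.inl (Or.inl ⟨⟨rfl, rfl⟩, by omega, by omega⟩)⟩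
    · exact ⟨_, _, Or.inr (Or.inl ⟨⟨rfl, rfl⟩, by omega, by omega⟩)⟩
    · exact ⟨c - d, c + d, Or.inr (Or.inr ⟨⟨by omega, by omega⟩, by omega, by omega⟩)⟩
    · exact ⟨c - d, c + d, Or.inl (Or.inr ⟨⟨by omega, by omega⟩, by omega, by omega⟩)⟩

theorem IsDomino.exists_parity {d : Finset Cell} (h : IsDomino d) :
    ∃ x y, d = {x, y} ∧ Odd (x.1 + x.2) ∧ Even (y.1 + y.2) := by
  obtain ⟨x, y, h | h⟩ := h <;> rcases Int.even_or_odd (x + y) with hp | hp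
  · exact ⟨(x + 1, y), (x, y), by rw [h, Finset.pair_comm], by simp only; grind, hp⟩
  · exact ⟨(x, y), (x + 1, y), h, hp, by simp only; grind⟩
  · exact ⟨(x, y + 1), (x, y), by rw [h, Finset.pair_comm], by simp only; grind, hp⟩
  · exact ⟨(x, y), (x, y + 1), h, hp, by simp only; grind⟩

theorem odd_oddCell {n : ℕ} (i : Fin ((n + 1) * n)) :
    Odd ((oddCell n i).1 + (oddCell n i).2) := ⟨oddColumn n i - 1, by simp only [oddCell]; ring⟩

theorem even_evenCell {n : ℕ} (p : Fin n × Fin (n + 1)) :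
    Even ((evenCell n p).1 + (evenCell n p).2) := ⟨p.1, by simp only [evenCell]; ring⟩

/-! ### Tilings as bijections between odd and even cells. -/

/-- A tiling matches each odd cell with the even cell of its domino. When `D` holds, the removed
cells are formally matched with each other, so both regions are described by bijections of the full
grids. -/
theorem numTilings_eq_ncard_isAztecMatching (n : ℕ) (D : Prop) (o : Fin ((n + 1) * n))
    (e : Fin n × Fin (n + 1)) (R : Finset Cell)
    (hR : ∀ x, x ∈ R ↔ (∃ i, ¬ (D ∧ i = o) ∧ oddCell n i = x) ∨
      ∃ p, ¬ (D ∧ p = e) ∧ evenCell n p = x) :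
    numTilings R = {f : Fin ((n + 1) * n) ≃ Fin n × Fin (n + 1) |
      IsAztecMatching (oddColumn n) (oddRow n) D o e f}.ncard := by
  classical
  let Φ : (Fin ((n + 1) * n) ≃ Fin n × Fin (n + 1)) → Finset (Finset Cell) := fun f =>
    (Finset.univ.filter fun i => ¬ (D ∧ i = o)).image fun i => {oddCell n i, evenCell n (f i)}
  have hΦ : ∀ f d, d ∈ Φ f ↔ ∃ i, ¬ (D ∧ i = o) ∧ {oddCell n i, evenCell n (f i)} = d := by
    intro f d
    simp [Φ]
  have hmem : ∀ i p x, x ∈ ({oddCell n i, evenCell n p} : Finset Cell) ↔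
      x = oddCell n i ∨ x = evenCell n p := by simp
  have hsp : ∀ f : Fin ((n + 1) * n) ≃ Fin n × Fin (n + 1), (D → f o = e) →
      ∀ i, (D ∧ f i = e ↔ D ∧ i = o) := fun f hf i =>
    and_congr_right fun hD => by rw [← hf hD, f.injective.eq_iff]
  have himage : {T | IsDominoTiling R T} =
      Φ '' {f | IsAztecMatching (oddColumn n) (oddRow n) D o e f} := by
    ext T
    constructor
    · rintro ⟨hdom, hdisj, hunion⟩
      have hsub : ∀ d ∈ T, ∀ x ∈ d, x ∈ R := by
        intro d hd x hx
        rw [← hunion]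
        exact Finset.mem_biUnion.2 ⟨d, hd, hx⟩
      have hshape : ∀ d ∈ T, ∃ i p, ¬ (D ∧ i = o) ∧ ¬ (D ∧ p = e) ∧
          d = {oddCell n i, evenCell n p} := by
        intro d hd
        obtain ⟨x, y, hxy, hx, hy⟩ := (hdom d hd).exists_parity
        have hx' := (hR x).1 (hsub d hd x (by simp [hxy]))
        have hy' := (hR y).1 (hsub d hd y (by simp [hxy]))
        obtain ⟨i, hi, rfl⟩ : ∃ i, ¬ (D ∧ i = o) ∧ oddCell n i = x := by
          refine hx'.resolve_right ?_
          rintro ⟨p, -, rfl⟩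
          exact Int.not_even_iff_odd.2 hx (even_evenCell p)
        obtain ⟨p, hp, rfl⟩ : ∃ p, ¬ (D ∧ p = e) ∧ evenCell n p = y := by
          refine hy'.resolve_left ?_
          rintro ⟨i, -, rfl⟩
          exact Int.not_even_iff_odd.2 (odd_oddCell i) hy
        exact ⟨i, p, hi, hp, hxy⟩
      have huniq : ∀ d ∈ T, ∀ d' ∈ T, ∀ x, x ∈ d → x ∈ d' → d = d' := by
        intro d hd d' hd' x hx hx'
        by_contra hne
        exact Finset.disjoint_left.1 (hdisj d hd d' hd' hne) hx hx'
      have hex : ∀ i, ∃ p, (D ∧ i = o → p = e) ∧ (¬ (D ∧ i = o) →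
          ¬ (D ∧ p = e) ∧ {oddCell n i, evenCell n p} ∈ T) := by
        intro i
        by_cases hi : D ∧ i = o
        · exact ⟨e, fun _ => rfl, fun h => absurd hi h⟩
        · have hiR : oddCell n i ∈ T.biUnion id := hunion ▸ (hR _).2 (Or.inl ⟨i, hi, rfl⟩)
          obtain ⟨d, hd, hid⟩ := Finset.mem_biUnion.1 hiR
          obtain ⟨k, p, hk, hp, rfl⟩ := hshape d hd
          rcases (hmem _ _ _).1 hid with h | h
          · obtain rfl := oddCell_injective n h
            exact ⟨p, fun h => absurd h hi, fun _ => ⟨hp, hd⟩⟩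
          · exact absurd h (oddCell_ne_evenCell i p)
      choose F hF1 hF2 using hex
      have hinj : Function.Injective F := by
        intro i j hij
        by_cases hi : D ∧ i = o <;> by_cases hj : D ∧ j = o
        · rw [hi.2, hj.2]
        · exact absurd ⟨hi.1, hij ▸ hF1 i hi⟩ (hF2 j hj).1
        · exact absurd ⟨hj.1, hij.symm ▸ hF1 j hj⟩ (hF2 i hi).1
        · have h := huniq _ (hF2 i hi).2 _ (hF2 j hj).2 (evenCell n (F i)) (by simp)
            (by simp [hij])
          have h2 : oddCell n i ∈ ({oddCell n j, evenCell n (F j)} : Finset Cell) := by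
            rw [← h]; simp
          rcases (hmem _ _ _).1 h2 with h | h
          · exact oddCell_injective n h
          · exact absurd h (oddCell_ne_evenCell _ _)
      -- Both colours have n(n + 1) cells, so injectivity suffices.
      have hbij : Function.Bijective F := by
        refine (Fintype.bijective_iff_injective_and_card F).2 ⟨hinj, ?_⟩
        simp [mul_comm]
      refine ⟨Equiv.ofBijective F hbij, ⟨fun hD => hF1 o ⟨hD, rfl⟩, fun i hi => ?_⟩, ?_⟩
      · exact (isDomino_iff_adjacent i _).1 (hdom _ (hF2 i hi).2)
      · ext d
        rw [hΦ]
        constructor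
        · rintro ⟨i, hi, rfl⟩
          exact (hF2 i hi).2
        · intro hd
          obtain ⟨i, p, hi, hp, rfl⟩ := hshape d hd
          exact ⟨i, hi, huniq _ (hF2 i hi).2 _ hd (oddCell n i) (by simp) (by simp)⟩
    · rintro ⟨f, ⟨hf1, hf2⟩, rfl⟩
      refine ⟨?_, ?_, ?_⟩
      · intro d hd
        obtain ⟨i, hi, rfl⟩ := (hΦ f d).1 hd
        exact (isDomino_iff_adjacent i (f i)).2 (hf2 i hi)
      · intro d hd d' hd' hne
        obtain ⟨i, hi, rfl⟩ := (hΦ f d).1 hd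
        obtain ⟨j, hj, rfl⟩ := (hΦ f d').1 hd'
        rw [Finset.disjoint_left]
        intro x hx hx'
        apply hne
        suffices i = j by rw [this]
        rcases (hmem _ _ _).1 hx with rfl | rfl <;> rcases (hmem _ _ _).1 hx' with h | h
        · exact oddCell_injective n h
        · exact absurd h (oddCell_ne_evenCell _ _)
        · exact absurd h.symm (oddCell_ne_evenCell _ _)
        · exact f.injective (evenCell_injective n h)
      · ext x
        rw [hR, Finset.mem_biUnion]
        constructor
        · rintro ⟨d, hd, hx⟩
          obtain ⟨i, hi, rfl⟩ := (hΦ f d).1 hd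
          rcases (hmem _ _ _).1 hx with rfl | rfl
          · exact Or.inl ⟨i, hi, rfl⟩
          · exact Or.inr ⟨f i, fun h => hi ((hsp f hf1 i).1 h), rfl⟩
        · rintro (⟨i, hi, rfl⟩ | ⟨p, hp, rfl⟩)
          · exact ⟨_, (hΦ f _).2 ⟨i, hi, rfl⟩, by simp⟩
          · obtain ⟨i, rfl⟩ := f.surjective p
            exact ⟨_, (hΦ f _).2 ⟨i, fun h => hp ((hsp f hf1 i).2 h), rfl⟩, by simp⟩
  rw [numTilings, himage, Set.InjOn.ncard_image]
  intro f hf g hg hfg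
  ext1 i
  by_cases hi : D ∧ i = o
  · rw [hi.2, hf.1 hi.1, hg.1 hi.1]
  · have h1 : {oddCell n i, evenCell n (f i)} ∈ Φ g := by
      rw [← hfg]
      exact (hΦ f _).2 ⟨i, hi, rfl⟩
    obtain ⟨k, hk, h⟩ := (hΦ g _).1 h1
    have h2 : oddCell n i ∈ ({oddCell n k, evenCell n (g k)} : Finset Cell) := by rw [h]; simp
    have h3 : evenCell n (f i) ∈ ({oddCell n k, evenCell n (g k)} : Finset Cell) := by rw [h]; simp
    rcases (hmem _ _ _).1 h2 with h2 | h2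
    · obtain rfl := oddCell_injective n h2
      rcases (hmem _ _ _).1 h3 with h3 | h3
      · exact absurd h3.symm (oddCell_ne_evenCell _ _)
      · exact evenCell_injective n h3
    · exact absurd h2 (oddCell_ne_evenCell _ _)

/-- The tiling by horizontal dominos: odd cells pair with their right neighbours in the lower half
and with their left neighbours in the upper half. -/
theorem exists_isAztecMatching (n : ℕ) (o : Fin ((n + 1) * n)) (e : Fin n × Fin (n + 1)) :
    ∃ f, IsAztecMatching (oddColumn n) (oddRow n) False o e f := by
  have hlt : ∀ i : Fin ((n + 1) * n), oddColumn n i + oddRow n i < n → oddColumn n i < n :=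
    fun i h => by omega
  have hlt' : ∀ i : Fin ((n + 1) * n), oddColumn n i - 1 < n := fun i => by
    have := oddColumn_lt i
    have := oddRow_lt i
    omega
  let F : Fin ((n + 1) * n) → Fin n × Fin (n + 1) := fun i =>
    if h : oddColumn n i + oddRow n i < n then
      (⟨oddColumn n i, hlt i h⟩, ⟨oddRow n i, (oddRow_lt i).trans n.lt_succ_self⟩)
    else (⟨oddColumn n i - 1, hlt' i⟩, ⟨oddRow n i + 1, Nat.succ_lt_succ (oddRow_lt i)⟩)
  have hF : ∀ i, (oddColumn n i + oddRow n i < n ∧ (F i).1.1 = oddColumn n i ∧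
      (F i).2.1 = oddRow n i) ∨ (n ≤ oddColumn n i + oddRow n i ∧
      (F i).1.1 + 1 = oddColumn n i ∧ (F i).2.1 = oddRow n i + 1) := by
    intro i
    have := oddRow_lt i
    by_cases h : oddColumn n i + oddRow n i < n
    · simp [F, h]
    · simp only [F, dif_neg h]
      exact Or.inr ⟨by omega, by omega, trivial⟩
  have hinj : Function.Injective F := by
    intro i j hij
    have hi := hF i
    have hj := hF j
    rw [hij] at hi
    exact eq_of_oddColumn_of_oddRow (by omega) (by omega)
  have hbij : Function.Bijective F :=
    (Fintype.bijective_iff_injective_and_card F).2 ⟨hinj, by simp [mul_comm]⟩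
  refine ⟨Equiv.ofBijective F hbij, fun h => h.elim, fun i _ => ?_⟩
  have := hF i
  simp only [Equiv.ofBijective_apply]
  omega

/-! ### The matrix system as a polynomial recursion. -/

theorem sum_ite_fin_prod {m n : ℕ} (k l : ℕ) (u : ℝ) (hu : m ≤ k → u = 0) (hl : l < n) :
    ∑ p : Fin m × Fin n, (if p.1.1 = k ∧ p.2.1 = l then u else 0) = u := by
  by_cases hk : k < m
  · rw [Fintype.sum_eq_single (⟨k, hk⟩, ⟨l, hl⟩)]
    · simp
    · rintro ⟨x, y⟩ hne
      refine if_neg fun h => hne (Prod.ext (Fin.ext h.1) (Fin.ext h.2))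
  · rw [hu (not_lt.1 hk)]
    simp

/-- The vanishing of y for c ≥ n covers a i = n, where the even column a i does not exist; the guard
0 < a i does the same for the column a i - 1. -/
theorem sum_kasteleyn_mul {N n : ℕ} (a b : Fin N → ℕ) (i : Fin N) (ha : a i ≤ n) (hb : b i < n)
    (y : ℕ → ℕ → ℝ) (hy : ∀ d ≤ n, ∀ c, n ≤ c → y c d = 0) :
    ∑ p : Fin n × Fin (n + 1), kasteleyn a b i p * y p.1 p.2 =
      y (a i) (b i + 1) - y (a i) (b i) +
        if 0 < a i then y (a i - 1) (b i + 1) + y (a i - 1) (b i) else 0 := by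
  have h1 : ∀ p : Fin n × Fin (n + 1), kasteleyn a b i p * y p.1 p.2 =
      (if p.1.1 = a i ∧ p.2.1 = b i + 1 then y (a i) (b i + 1) else 0) +
      (if p.1.1 = a i ∧ p.2.1 = b i then -y (a i) (b i) else 0) +
      ((if p.1.1 = a i - 1 ∧ p.2.1 = b i + 1 then
        (if 0 < a i then y (a i - 1) (b i + 1) else 0) else 0) +
      (if p.1.1 = a i - 1 ∧ p.2.1 = b i then
        (if 0 < a i then y (a i - 1) (b i) else 0) else 0)) := by
    rintro ⟨⟨c, hc⟩, ⟨d, hd⟩⟩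
    simp only [kasteleyn]
    by_cases hd1 : d = b i
    · subst hd1
      rcases Nat.eq_zero_or_pos (a i) with h0 | h0
      · by_cases hc1 : c = 0 <;> simp [hc1, h0]
      · by_cases hc1 : c = a i
        · have : ¬ a i = a i - 1 := by omega
          simp [hc1, this]
        · by_cases hc2 : c = a i - 1
          · have : a i - 1 + 1 = a i := by omega
            have h4 : ¬ a i - 1 = a i := by omega
            simp [hc2, h0, this, h4]
          · have : ¬ c + 1 = a i := by omega
            simp [hc1, hc2, this]
    · by_cases hd2 : d = b i + 1
      · subst hd2
        rcases Nat.eq_zero_or_pos (a i) with h0 | h0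
        · by_cases hc1 : c = 0 <;> simp [hc1, h0]
        · by_cases hc1 : c = a i
          · have : ¬ a i = a i - 1 := by omega
            simp [hc1, this]
          · by_cases hc2 : c = a i - 1
            · have : a i - 1 + 1 = a i := by omega
              have h4 : ¬ a i - 1 = a i := by omega
              simp [hc2, h0, this, h4]
            · have : ¬ c + 1 = a i := by omega
              simp [hc1, hc2, this]
      · simp [hd1, hd2]
  simp only [h1, Finset.sum_add_distrib]
  rw [sum_ite_fin_prod _ _ _ (fun h => hy _ (by omega) _ h) (by omega),
    sum_ite_fin_prod _ _ _ (fun h => by rw [hy _ (by omega) _ h, neg_zero]) (by omega),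
    sum_ite_fin_prod _ _ _ (fun h => by rw [if_neg (by omega)]) (by omega),
    sum_ite_fin_prod _ _ _ (fun h => by rw [if_neg (by omega)]) (by omega)]
  split_ifs <;> ring

-- The row of the odd cell (a, b) is the coefficient of X^a in the recursion at d = b; the degree
-- bound makes the coefficients beyond the grid vanish.
open Polynomial in
theorem sum_kasteleyn_mul_coeff (n m : ℕ) (Y : ℕ → ℝ[X]) (hdeg : ∀ d ≤ n, (Y d).natDegree < n)
    (hrec : ∀ d < n, (1 + X) * Y (d + 1) = (1 - X) * Y d + if d = m then 1 else 0)
    (i : Fin ((n + 1) * n)) :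
    ∑ p : Fin n × Fin (n + 1), kasteleyn (oddColumn n) (oddRow n) i p * (Y p.2).coeff p.1 =
      if oddColumn n i = 0 ∧ oddRow n i = m then 1 else 0 := by
  rw [sum_kasteleyn_mul _ _ i (Nat.le_of_lt_succ (oddColumn_lt i)) (oddRow_lt i)
    (fun c d => (Y d).coeff c)
    (fun d hd c hc => coeff_eq_zero_of_natDegree_lt ((hdeg d hd).trans_le hc))]
  have h := congrArg (fun q => q.coeff (oddColumn n i)) (hrec _ (oddRow_lt i))
  have hδ : (if oddRow n i = m then 1 else 0 : ℝ[X]).coeff (oddColumn n i) =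
      if oddColumn n i = 0 ∧ oddRow n i = m then 1 else 0 := by
    by_cases h : oddRow n i = m
    · simp [h, coeff_one]
    · simp [h]
  simp only [add_mul, sub_mul, one_mul, coeff_add, coeff_sub, hδ] at h
  rcases hc : oddColumn n i with _ | c
  · simp only [hc, mul_coeff_zero, coeff_X_zero, zero_mul, add_zero, sub_zero] at h ⊢
    simp only [lt_irrefl, if_false]
    linear_combination h
  · simp only [hc, coeff_X_mul] at h ⊢
    simp only [Nat.succ_pos, if_true, Nat.add_sub_cancel]
    linear_combination h

/-! ### Cramer's rule and the conclusion. -/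

theorem numTilings_aztecDiamond (n : ℕ) (o : Fin ((n + 1) * n)) (e : Fin n × Fin (n + 1)) :
    numTilings (aztecDiamond n) = {f : Fin ((n + 1) * n) ≃ Fin n × Fin (n + 1) |
      IsAztecMatching (oddColumn n) (oddRow n) False o e f}.ncard := by
  refine numTilings_eq_ncard_isAztecMatching n False o e _ fun x => ?_
  simp [mem_aztecDiamond_iff]

theorem numTilings_aztecDiamond_pos (n : ℕ) (o : Fin ((n + 1) * n)) (e : Fin n × Fin (n + 1)) :
    0 < numTilings (aztecDiamond n) := by
  rw [numTilings_aztecDiamond n o e, Set.ncard_pos (Set.toFinite _)]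
  exact exists_isAztecMatching n o e

theorem numTilings_dentedAztecDiamond (n i j : ℕ) (o : Fin ((n + 1) * n))
    (e : Fin n × Fin (n + 1)) (ho : oddCell n o = swSquare i) (he : evenCell n e = seSquare j) :
    numTilings (dentedAztecDiamond n i j) = {f : Fin ((n + 1) * n) ≃ Fin n × Fin (n + 1) |
      IsAztecMatching (oddColumn n) (oddRow n) True o e f}.ncard := by
  refine numTilings_eq_ncard_isAztecMatching n True o e _ fun x => ?_
  rw [dentedAztecDiamond, ← ho, ← he, Finset.mem_sdiff, mem_aztecDiamond_iff]
  simp only [Finset.mem_insert, Finset.mem_singleton, true_and, not_or]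
  constructor
  · rintro ⟨⟨k, rfl⟩ | ⟨p, rfl⟩, h1, h2⟩
    · exact Or.inl ⟨k, fun h => h1 (by rw [h]), rfl⟩
    · exact Or.inr ⟨p, fun h => h2 (by rw [h]), rfl⟩
  · rintro (⟨k, hk, rfl⟩ | ⟨p, hp, rfl⟩)
    · exact ⟨Or.inl ⟨k, rfl⟩, fun h => hk (oddCell_injective n h), oddCell_ne_evenCell k e⟩
    · exact ⟨Or.inr ⟨p, rfl⟩, (oddCell_ne_evenCell o p).symm,
        fun h => hp (evenCell_injective n h)⟩

theorem numTilings_dented_div (n i j : ℕ) (hi : 1 ≤ i) (hin : i ≤ n) (hj : 1 ≤ j) (hjn : j ≤ n) :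
    (numTilings (dentedAztecDiamond n i j) : ℝ) / (numTilings (aztecDiamond n) : ℝ) =
      ∑ k ∈ Finset.range n,
        ((k.choose (i - 1) : ℕ) : ℝ) * ((k.choose (j - 1) : ℕ) : ℝ) * (1 / 2 ^ (k + 1)) := by
  obtain ⟨o, ho1, ho2⟩ := exists_oddColumn_oddRow (n := n) (x := 0) (y := i - 1) (by omega)
    (by omega)
  set e : Fin n × Fin (n + 1) := (⟨j - 1, by omega⟩, 0) with he
  have hoc : oddCell n o = swSquare i := by
    simp only [oddCell, swSquare, ho1, ho2, Prod.mk.injEq]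
    omega
  have hec : evenCell n e = seSquare j := by
    simp only [evenCell, seSquare, he, Prod.mk.injEq, Fin.val_zero]
    omega
  obtain ⟨Y, hdeg, hrec, hY0⟩ := exists_polynomial_column n (i - 1) (by omega)
  have ρ : Fin n × Fin (n + 1) ≃ Fin ((n + 1) * n) :=
    Fintype.equivOfCardEq (by simp [mul_comm])
  set K : Matrix (Fin ((n + 1) * n)) (Fin ((n + 1) * n)) ℝ :=
    Matrix.of fun k l => kasteleyn (oddColumn n) (oddRow n) k (ρ.symm l) with hK
  set v : Fin ((n + 1) * n) → ℝ := fun l => (Y (ρ.symm l).2).coeff (ρ.symm l).1 with hv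
  have hKv : K.mulVec v = Pi.single o 1 := by
    ext k
    have h1 : K.mulVec v k = ∑ p : Fin n × Fin (n + 1),
        kasteleyn (oddColumn n) (oddRow n) k p * (Y p.2).coeff p.1 := by
      rw [← Equiv.sum_comp ρ.symm]
      rfl
    have h2 : (oddColumn n k = 0 ∧ oddRow n k = i - 1) ↔ k = o := by
      rw [← ho1, ← ho2]
      exact ⟨fun h => eq_of_oddColumn_of_oddRow h.1 h.2, fun h => by rw [h]; exact ⟨rfl, rfl⟩⟩
    rw [h1, sum_kasteleyn_mul_coeff n (i - 1) Y hdeg hrec, Pi.single_apply]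
    simp only [h2]
  -- Cramer's rule via the adjugate, which does not require knowing beforehand that K is invertible.
  have hcramer : (K.updateCol (ρ e) (Pi.single o 1)).det = K.det * v (ρ e) := by
    rw [← hKv, ← Matrix.cramer_apply, Matrix.cramer_eq_adjugate_mulVec, Matrix.mulVec_mulVec,
      Matrix.adjugate_mul, Matrix.smul_mulVec, Matrix.one_mulVec, Pi.smul_apply, smul_eq_mul]
  have hM : |K.det| = numTilings (aztecDiamond n) := by
    rw [numTilings_aztecDiamond n o e, ← abs_det_dentedKasteleyn (oddColumn n) (oddRow n) False o e
      ρ lt_iff_oddColumn_oddRow ho1 rfl card_oddRow_gt]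
    congr 2
  have hM' : |(K.updateCol (ρ e) (Pi.single o 1)).det| =
      numTilings (dentedAztecDiamond n i j) := by
    rw [numTilings_dentedAztecDiamond n i j o e hoc hec,
      ← abs_det_dentedKasteleyn (oddColumn n) (oddRow n) True o e
      ρ lt_iff_oddColumn_oddRow ho1 rfl card_oddRow_gt]
    congr 2
    ext k l
    simp only [hK, dentedKasteleyn, Matrix.updateCol_apply, Pi.single_apply, Matrix.of_apply,
      true_and, Equiv.symm_apply_eq]
  -- Since e = (j - 1, 0), this is the coefficient of X^(j-1) in Y 0, and (1 + X)^k contributes C(k,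
  -- j-1).
  have hve : v (ρ e) = -∑ k ∈ Finset.range n,
      ((k.choose (i - 1) : ℕ) : ℝ) * ((k.choose (j - 1) : ℕ) : ℝ) * (1 / 2 ^ (k + 1)) := by
    simp only [hv, ρ.symm_apply_apply, he, Fin.val_zero, hY0, Polynomial.coeff_neg,
      Polynomial.finsetSum_coeff, Polynomial.coeff_C_mul, Polynomial.coeff_one_add_X_pow]
    congr 1
    exact Finset.sum_congr rfl fun k _ => by ring
  have hpos : (0 : ℝ) < numTilings (aztecDiamond n) := by
    exact_mod_cast numTilings_aztecDiamond_pos n o e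
  rw [← hM', hcramer, abs_mul, hM, hve, abs_neg, mul_div_cancel_left₀ _ hpos.ne']
  exact abs_of_nonneg (Finset.sum_nonneg fun k _ => by positivity)

theorem theorem2p1 :
    (∀ n i j : ℕ, 1 ≤ i → i ≤ n → 1 ≤ j → j ≤ n →
      (numTilings (dentedAztecDiamond n i j) : ℝ) / (numTilings (aztecDiamond n) : ℝ) =
        ∑ k ∈ Finset.range n,
          ((k.choose (i - 1) : ℕ) : ℝ) * ((k.choose (j - 1) : ℕ) : ℝ) * (1 / 2 ^ (k + 1))) ∧
    (∀ i j : ℕ, 1 ≤ i → 1 ≤ j →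
      Tendsto
        (fun n : ℕ =>
          (numTilings (dentedAztecDiamond n i j) : ℝ) / (numTilings (aztecDiamond n) : ℝ))
        atTop (𝓝 (delannoy (i - 1) (j - 1) : ℝ))) := by
  refine ⟨fun n i j hi hin hj hjn => numTilings_dented_div n i j hi hin hj hjn,
    fun i j hi hj => ?_⟩
  refine (hasSum_choose_mul_choose (i - 1) (j - 1)).tendsto_sum_nat.congr' ?_
  -- The finite formula needs both dents to lie on the diamond.
  filter_upwards [eventually_ge_atTop (max i j)] with n hn
  exact (numTilings_dented_div n i j hi (le_trans (le_max_left _ _) hn) hj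
    (le_trans (le_max_right _ _) hn)).symm
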